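/- Corollary 1.1. For every integer $n\ge 0$, the following two numbers are equal. (1) The number of partitions of $n$ into distinct parts, each congruent to $-2^3,-2^2,-2^1$ or $-2^0$ (that is, $-8,-4,-2$ or $-1$) modulo $12$. (2) The number of partitions $\lambda_1\ge\lambda_2\ge\cdots\ge\lambda_s$ of $n$ into parts not congruent to $1$ or $5$ modulo $12$ and different from $2,3,6,7,9$, such that for every $1\le i<s$ one of the following holds: * $\lambda_i-\lambda_{i+1}>12$; * $\lambda_i-\lambda_{i+1}=12$ and $\lambda_i\equiv -2^3,-2^2,-2^1$ or $-2^0 \pmod{12}$; * $\lambda_i-\lambda_{i+1}=9$, $\lambda_i\equiv\pm3\pmod{12}$, and, if $i+2\le s$, either $\lambda_i-\lambda_{i+2}\ge 24$ or $(\lambda_i,\lambda_{i+1},\lambda_{i+2})=(27,18,4)$. -/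

import Mathlib

/-- `m ≡ -2^3, -2^2, -2^1` or `-2^0` modulo `12`. -/
def IsPrimaryResidue (m : ℕ) : Prop :=
  (m : ℤ) ≡ -2 ^ 3 [ZMOD 12] ∨ (m : ℤ) ≡ -2 ^ 2 [ZMOD 12] ∨
    (m : ℤ) ≡ -2 ^ 1 [ZMOD 12] ∨ (m : ℤ) ≡ -2 ^ 0 [ZMOD 12]

/-- The parts of a partition in non-increasing order `λ₁ ≥ λ₂ ≥ ⋯`. -/
def partsDesc {n : ℕ} (p : n.Partition) : List ℕ :=
  p.parts.sort (· ≥ ·)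

/-- Partitions of the first kind: the parts are pairwise distinct, and each of them is congruent
to `-2^3, -2^2, -2^1` or `-2^0` modulo `12`. -/
def IsFirstKind {n : ℕ} (p : n.Partition) : Prop :=
  p.parts.Nodup ∧ ∀ m ∈ p.parts, IsPrimaryResidue m

/-- The parts that may occur in a partition of the second kind. -/
def IsAllowedPart (m : ℕ) : Prop :=
  ¬ m ≡ 1 [MOD 12] ∧ ¬ m ≡ 5 [MOD 12] ∧
    m ≠ 2 ∧ m ≠ 3 ∧ m ≠ 6 ∧ m ≠ 7 ∧ m ≠ 9

/-- The difference conditions on a non-increasing sequence of parts: any two consecutive parts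
differ by more than `12`, or by exactly `12` under a congruence condition on the larger part, or
by exactly `9` under a congruence condition on the larger part and a condition on the part that
comes next, if there is one. The three consecutive parts `27, 18, 4` are exempt from the latter. -/
def GapConditions (l : List ℕ) : Prop :=
  ∀ (i : ℕ) (_ : i + 1 < l.length),
    ((l[i] : ℤ) - (l[i + 1] : ℤ) > 12) ∨
    ((l[i] : ℤ) - (l[i + 1] : ℤ) = 12 ∧ IsPrimaryResidue l[i]) ∨
    ((l[i] : ℤ) - (l[i + 1] : ℤ) = 9 ∧
      ((l[i] : ℤ) ≡ 3 [ZMOD 12] ∨ (l[i] : ℤ) ≡ -3 [ZMOD 12]) ∧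
      ∀ _ : i + 2 < l.length,
        (l[i] : ℤ) - (l[i + 2] : ℤ) ≥ 24 ∨ (l[i] = 27 ∧ l[i + 1] = 18 ∧ l[i + 2] = 4))

/-- Partitions of the second kind. -/
def IsSecondKind {n : ℕ} (p : n.Partition) : Prop :=
  (∀ m ∈ p.parts, IsAllowedPart m) ∧ GapConditions (partsDesc p)

/-! The six sums of two distinct residues among 4, 8, 10, 11 differ modulo 12. Hence a sum of two
primary numbers less than 12 apart determines both summands, and such sums are exactly the allowed
parts that are not primary.

From a list of distinct primary numbers, add up the first close pair and move the sum to the front,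
taking 12 from each entry passed; if this is impossible, the head stays as a part. Repeat on the
rest. Sinking a sum and splitting it undoes one move (`liftPair_spec`).

The substance is that the gap conditions describe the image. By `recoverable_iff`, a sunk sum `s`
can be lifted out again exactly when `s` may precede the regrouped list; `liftPair_cons_eq_none_iff`
is the analogue for a primary part. So `regroup` has well-spaced values and `ungroup` inverts it. -/

/-! ### Primary and secondary numbers -/

/-- `m` is congruent to `4`, `8`, `10` or `11` modulo `12`. -/
def Primary (m : ℕ) : Prop := m % 12 = 4 ∨ m % 12 = 8 ∨ m % 12 = 10 ∨ m % 12 = 11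

/-- `s` is the sum of two primary numbers that are incongruent modulo `12`. -/
def Secondary (s : ℕ) : Prop :=
  12 ≤ s ∧ (s % 12 = 0 ∨ s % 12 = 2 ∨ s % 12 = 3 ∨ s % 12 = 6 ∨ s % 12 = 7 ∨ s % 12 = 9)

instance : DecidablePred Primary := fun m => by unfold Primary; infer_instance

theorem Primary.not_secondary {m : ℕ} (h : Primary m) : ¬ Secondary m := by
  unfold Primary at h; unfold Secondary; omega

theorem Primary.four_le {m : ℕ} (h : Primary m) : 4 ≤ m := by
  unfold Primary at h; omega

/-- The smaller of the two primary numbers which differ by less than `12` and add up to `s`. -/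
def lowerHalf (s : ℕ) : ℕ :=
  (s - if s % 24 = 12 then 4 else if s % 24 = 0 then 8 else if s % 24 = 14 then 6
    else if s % 24 = 2 then 6 else if s % 24 = 15 then 7 else if s % 24 = 3 then 5
    else if s % 24 = 18 then 2 else if s % 24 = 6 then 10 else if s % 24 = 19 then 3
    else if s % 24 = 7 then 9 else if s % 24 = 21 then 1 else 11) / 2

/-- The larger of the two primary numbers which differ by less than `12` and add up to `s`. -/
def upperHalf (s : ℕ) : ℕ := s - lowerHalf s

/-- `u` and `v` are primary, add up to `s`, and `u` exceeds `v` by less than `12`. -/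
structure IsHalves (s u v : ℕ) : Prop where
  upper : Primary u
  lower : Primary v
  lt : v < u
  lt_add : u < v + 12
  add : u + v = s

/-- The residue of `s` modulo 12 gives the residues of the halves, and the residue modulo 24 decides
which is larger. The constants in `lowerHalf` are the differences of the halves. -/
theorem Secondary.isHalves {s : ℕ} (h : Secondary s) :
    IsHalves s (upperHalf s) (lowerHalf s) := by
  obtain ⟨h12, h⟩ := h
  have h24 : s % 24 = 12 ∨ s % 24 = 0 ∨ s % 24 = 14 ∨ s % 24 = 2 ∨ s % 24 = 15 ∨ s % 24 = 3 ∨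
    s % 24 = 18 ∨ s % 24 = 6 ∨ s % 24 = 19 ∨ s % 24 = 7 ∨ s % 24 = 21 ∨ s % 24 = 9 := by omega
  clear h
  rcases h24 with h | h | h | h | h | h | h | h | h | h | h | h <;>
    constructor <;> simp [upperHalf, lowerHalf, Primary, h] <;> omega

theorem IsHalves.secondary {s u v : ℕ} (h : IsHalves s u v) : Secondary s := by
  obtain ⟨hu, hv, h1, h2, rfl⟩ := h
  unfold Primary at hu hv
  unfold Secondary
  omega

theorem IsHalves.unique {s u v u' v' : ℕ} (h : IsHalves s u v) (h' : IsHalves s u' v') :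
    u = u' ∧ v = v' := by
  obtain ⟨hu, hv, h1, h2, h3⟩ := h
  obtain ⟨hu', hv', h1', h2', h3'⟩ := h'
  unfold Primary at hu hv hu' hv'
  rcases hu with hu | hu | hu | hu <;> rcases hv with hv | hv | hv | hv <;> omega

theorem IsHalves.upperHalf_eq {s u v : ℕ} (h : IsHalves s u v) : upperHalf s = u :=
  (h.secondary.isHalves.unique h).1

theorem IsHalves.lowerHalf_eq {s u v : ℕ} (h : IsHalves s u v) : lowerHalf s = v :=
  (h.secondary.isHalves.unique h).2

theorem Primary.add_twelve {m : ℕ} (h : Primary m) : Primary (m + 12) := by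
  unfold Primary at *; omega

theorem Primary.sub_twelve {m : ℕ} (h : Primary m) (hm : 12 ≤ m) : Primary (m - 12) := by
  unfold Primary at *; omega

/-- The halves trade places whenever a sum passes an entry. -/
theorem IsHalves.add_twelve {s u v : ℕ} (h : IsHalves s u v) : IsHalves (s + 12) (v + 12) u :=
  ⟨h.lower.add_twelve, h.upper, h.lt_add, by have := h.lt; omega, by have := h.add; omega⟩

theorem Secondary.sub_twelve {s : ℕ} (h : Secondary s) (hs : 24 ≤ s) : Secondary (s - 12) := by
  unfold Secondary at *; omega

theorem Secondary.lowerHalf_sub {s : ℕ} (h : Secondary s) (hs : 24 ≤ s) :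
    lowerHalf (s - 12) + 12 = upperHalf s := by
  have := (h.sub_twelve hs).isHalves.add_twelve
  rw [Nat.sub_add_cancel (by omega)] at this
  exact this.upperHalf_eq.symm

theorem Secondary.upperHalf_sub {s : ℕ} (h : Secondary s) (hs : 24 ≤ s) :
    upperHalf (s - 12) = lowerHalf s := by
  have := (h.sub_twelve hs).isHalves.add_twelve
  rw [Nat.sub_add_cancel (by omega)] at this
  exact this.lowerHalf_eq.symm

/-! ### Lifting and sinking a close pair -/

/-- A strictly decreasing list of primary numbers. -/
def DistinctPrimary : List ℕ → Prop
  | [] => True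
  | [x] => Primary x
  | x :: y :: l => Primary x ∧ y < x ∧ DistinctPrimary (y :: l)

theorem DistinctPrimary.head {x : ℕ} {l : List ℕ} (h : DistinctPrimary (x :: l)) : Primary x := by
  cases l with
  | nil => exact h
  | cons y l => exact h.1

theorem DistinctPrimary.tail {x : ℕ} {l : List ℕ} (h : DistinctPrimary (x :: l)) :
    DistinctPrimary l := by
  cases l with
  | nil => trivial
  | cons y l => exact h.2.2

theorem distinctPrimary_cons {x : ℕ} {l : List ℕ} :
    DistinctPrimary (x :: l) ↔ Primary x ∧ (∀ y ∈ l.head?, y < x) ∧ DistinctPrimary l := by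
  cases l with
  | nil => simp [DistinctPrimary]
  | cons y l => simp [DistinctPrimary]

/-- Adds up the first two consecutive entries that differ by less than `12`, and moves the sum to
the front of the list. When it passes an entry it grows by `12` and that entry shrinks by `12`.
The result is `none` if there is no such pair or if its sum meets an entry that exceeds it by more
than `12`. -/
def liftPair : List ℕ → Option (ℕ × List ℕ)
  | [] => none
  | [_] => none
  | x :: y :: l =>
    if x < y + 12 then some (x + y, l)
    else match liftPair (y :: l) with
      | none => none
      | some (s, r) => if x ≤ s + 12 then some (s + 12, (x - 12) :: r) else none

/-- Moves `s` down the list past every entry that is at least its lower half, and splits it there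
into its two halves. -/
def sinkPart : ℕ → List ℕ → List ℕ
  | s, [] => [upperHalf s, lowerHalf s]
  | s, x :: l => if x < lowerHalf s then upperHalf s :: lowerHalf s :: x :: l
    else (x + 12) :: sinkPart (s - 12) l

theorem liftPair_of_lt {x y : ℕ} {l : List ℕ} (h : x < y + 12) :
    liftPair (x :: y :: l) = some (x + y, l) := by
  simp [liftPair, h]

theorem liftPair_eq_some {x y s : ℕ} {l r : List ℕ} :
    liftPair (x :: y :: l) = some (s, r) ↔
      (x < y + 12 ∧ s = x + y ∧ r = l) ∨
      (y + 12 ≤ x ∧ ∃ s' r', liftPair (y :: l) = some (s', r') ∧ x ≤ s' + 12 ∧ s = s' + 12 ∧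
        r = (x - 12) :: r') := by
  rw [liftPair]
  split_ifs with h
  · simp [h, eq_comm]
  · rcases h' : liftPair (y :: l) with _ | ⟨s', r'⟩
    · simp [h]
    · simp only [h, false_and, false_or, Option.some.injEq, Prod.mk.injEq]
      constructor
      · intro h2
        split_ifs at h2 with h3
        simp only [Option.some.injEq, Prod.mk.injEq] at h2
        exact ⟨by omega, s', r', ⟨rfl, rfl⟩, h3, h2.1.symm, h2.2.symm⟩
      · rintro ⟨_, _, _, ⟨rfl, rfl⟩, h3, rfl, rfl⟩
        simp [h3]

theorem liftPair_eq_none {x y : ℕ} {l : List ℕ} :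
    liftPair (x :: y :: l) = none ↔
      y + 12 ≤ x ∧ ∀ s r, liftPair (y :: l) = some (s, r) → s + 12 < x := by
  rw [liftPair]
  split_ifs with h
  · simp; omega
  · rcases h' : liftPair (y :: l) with _ | ⟨s', r'⟩
    · simp; omega
    · simp only [ite_eq_right_iff, Option.some.injEq, Prod.mk.injEq, reduceCtorEq, imp_false,
        not_le]
      constructor
      · exact fun h2 => ⟨by omega, by rintro _ _ ⟨rfl, rfl⟩; exact h2⟩
      · exact fun h2 => h2.2 _ _ ⟨rfl, rfl⟩

theorem upperHalf_le_head_sinkPart {s : ℕ} (hs : Secondary s) (l : List ℕ) :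
    ∀ x ∈ (sinkPart s l).head?, upperHalf s ≤ x := by
  have := hs.isHalves.lt_add
  cases l with
  | nil => simp [sinkPart]
  | cons y l =>
    rw [sinkPart]
    split_ifs with h
    · simp
    · simp; omega

/-- What `liftPair` removes, `sinkPart` puts back. -/
theorem liftPair_spec : ∀ {l : List ℕ} {s : ℕ} {r : List ℕ}, DistinctPrimary l →
    liftPair l = some (s, r) → Secondary s ∧ DistinctPrimary r ∧ sinkPart s r = l ∧
      r.length + 2 = l.length ∧ s + r.sum = l.sum ∧ (∀ x ∈ l.head?, x ≤ s) ∧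
      ∀ x ∈ l.head?, ∀ y ∈ r.head?, y < x := by
  intro l
  induction l with
  | nil => simp [liftPair]
  | cons x l ih =>
    cases l with
    | nil => simp [liftPair]
    | cons y l =>
      intro s r hD h
      rcases liftPair_eq_some.1 h with ⟨hxy, rfl, rfl⟩ | ⟨hxy, s', r', h', hs', rfl, rfl⟩
      · have hh : IsHalves (x + y) x y := ⟨hD.1, hD.tail.head, hD.2.1, hxy, rfl⟩
        have hy := (distinctPrimary_cons.1 hD.tail).2.1
        have hlt := hD.2.1
        refine ⟨hh.secondary, hD.tail.tail, ?_, by simp, by simp [add_assoc], ?_, ?_⟩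
        · cases r with
          | nil => simp [sinkPart, hh.upperHalf_eq, hh.lowerHalf_eq]
          | cons z r =>
            rw [sinkPart, hh.upperHalf_eq, hh.lowerHalf_eq, if_pos (hy z rfl)]
        · simp
        · intro a ha b hb
          have := hy b hb
          simp at ha
          omega
      · obtain ⟨h1, h2, h3, h4, h5, h6, h7⟩ := ih hD.tail h'
        simp only [List.head?_cons, Option.mem_def, Option.some.injEq, forall_eq'] at h6 h7
        have hup := upperHalf_le_head_sinkPart h1 r'
        rw [h3] at hup
        have hup := hup y rfl
        have hh := h1.isHalves.add_twelve
        refine ⟨hh.secondary, distinctPrimary_cons.2 ⟨hD.1.sub_twelve (by omega), ?_, h2⟩, ?_,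
          by simp at h4 ⊢; omega, by simp at h5 ⊢; omega, by simp; omega, by simp; omega⟩
        · intro b hb
          have := h7 b hb
          omega
        · rw [sinkPart, hh.lowerHalf_eq, if_neg (by omega), Nat.add_sub_cancel, h3,
            Nat.sub_add_cancel (by omega)]

theorem length_lt_of_liftPair : ∀ {l : List ℕ} {s : ℕ} {r : List ℕ},
    liftPair l = some (s, r) → r.length < l.length
  | [], _, _, h => by simp [liftPair] at h
  | [_], _, _, h => by simp [liftPair] at h
  | x :: y :: l, s, r, h => by
    rcases liftPair_eq_some.1 h with ⟨_, _, rfl⟩ | ⟨_, s', r', h', _, _, rfl⟩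
    · simp
    · have := length_lt_of_liftPair h'
      simpa using this

/-! ### Regrouping and the gap conditions -/

/-- Turns a list of distinct primary numbers into a list of primary and secondary numbers, by
lifting sums of close pairs as far as possible. -/
def regroup (l : List ℕ) : List ℕ :=
  match l with
  | [] => []
  | x :: l =>
    match h : liftPair (x :: l) with
    | none => x :: regroup l
    | some (s, r) =>
      have : r.length < l.length + 1 := length_lt_of_liftPair h
      s :: regroup r
termination_by l.length

theorem regroup_nil : regroup [] = [] := by
  rw [regroup]

theorem regroup_of_none {x : ℕ} {l : List ℕ} (h : liftPair (x :: l) = none) :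
    regroup (x :: l) = x :: regroup l := by
  rw [regroup]
  split <;> simp_all

theorem regroup_of_some {l : List ℕ} {s : ℕ} {r : List ℕ} (h : liftPair l = some (s, r)) :
    regroup l = s :: regroup r := by
  cases l with
  | nil => simp [liftPair] at h
  | cons x l =>
    rw [regroup]
    split <;> simp_all

/-- The conditions which relate a part `a` to the list `l` of the parts that follow it. -/
def GapBefore (a : ℕ) (l : List ℕ) : Prop :=
  ∀ b ∈ l.head?, b + 12 < a ∨ (a = b + 12 ∧ Primary a) ∨
    (a = b + 9 ∧ (a % 12 = 3 ∨ a % 12 = 9) ∧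
      ∀ c ∈ l.tail.head?, c + 24 ≤ a ∨ (a = 27 ∧ b = 18 ∧ c = 4))

/-- A list of primary and secondary numbers in which every entry satisfies the gap conditions. -/
def WellSpaced : List ℕ → Prop
  | [] => True
  | a :: l => (Primary a ∨ Secondary a) ∧ GapBefore a l ∧ WellSpaced l

theorem gapBefore_cons {a b : ℕ} {l : List ℕ} :
    GapBefore a (b :: l) ↔ b + 12 < a ∨ (a = b + 12 ∧ Primary a) ∨
      (a = b + 9 ∧ (a % 12 = 3 ∨ a % 12 = 9) ∧
        ∀ c ∈ l.head?, c + 24 ≤ a ∨ (a = 27 ∧ b = 18 ∧ c = 4)) := by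
  simp [GapBefore]

theorem gapBefore_nil {a : ℕ} : GapBefore a [] := by simp [GapBefore]

/-- Subtracting 9 from a number congruent to 3 or 9 leaves 6 or 0 modulo 12, so a difference of 9
occurs only between secondary parts. -/
theorem gapBefore_secondary_primary {s x : ℕ} {l : List ℕ} (hs : Secondary s) (hx : Primary x) :
    GapBefore s (x :: l) ↔ x + 12 < s := by
  rw [gapBefore_cons]
  constructor
  · rintro (h | ⟨h, hp⟩ | ⟨h, hp, -⟩)
    · exact h
    · exact absurd hs hp.not_secondary
    · unfold Primary at hx
      omega
  · exact Or.inl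

theorem gapBefore_secondary {s b : ℕ} {l : List ℕ} (hs : Secondary s) :
    GapBefore s (b :: l) ↔ b + 12 < s ∨
      (s = b + 9 ∧ (s % 12 = 3 ∨ s % 12 = 9) ∧
        ∀ c ∈ l.head?, c + 24 ≤ s ∨ (s = 27 ∧ b = 18 ∧ c = 4)) := by
  rw [gapBefore_cons]
  have := fun h : Primary s => h.not_secondary hs
  tauto

theorem gapBefore_primary_secondary {x s : ℕ} {l : List ℕ} (hx : Primary x) (hs : Secondary s) :
    GapBefore x (s :: l) ↔ s + 12 < x := by
  rw [gapBefore_cons]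
  unfold Primary at *
  unfold Secondary at hs
  constructor
  · rintro (h | ⟨h, hp⟩ | ⟨h, hp, -⟩) <;> omega
  · exact Or.inl

theorem gapBefore_primary_primary {x y : ℕ} {l : List ℕ} (hx : Primary x) :
    GapBefore x (y :: l) ↔ y + 12 ≤ x := by
  rw [gapBefore_cons]
  constructor
  · rintro (h | ⟨h, hp⟩ | ⟨h, hp, -⟩)
    · omega
    · omega
    · unfold Primary at hx
      omega
  · intro h
    rcases h.lt_or_eq with h | h
    · exact Or.inl h
    · exact Or.inr (Or.inl ⟨h.symm, hx⟩)

/-! ### When sinking can be undone -/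

/-- Sinking `s` into `l` gives a list of distinct primary numbers from which `liftPair` recovers
`s` and `l`. -/
def Recoverable (s : ℕ) (l : List ℕ) : Prop :=
  DistinctPrimary (sinkPart s l) ∧ liftPair (sinkPart s l) = some (s, l)

theorem recoverable_of_lt {s : ℕ} {l : List ℕ} (hs : Secondary s) (hl : DistinctPrimary l)
    (h : ∀ x ∈ l.head?, x < lowerHalf s) : Recoverable s l := by
  have hh := hs.isHalves
  have hsink : sinkPart s l = upperHalf s :: lowerHalf s :: l := by
    cases l with
    | nil => rfl
    | cons x l => rw [sinkPart, if_pos (h x rfl)]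
  rw [Recoverable, hsink, liftPair_of_lt hh.lt_add, hh.add]
  exact ⟨⟨hh.upper, hh.lt, distinctPrimary_cons.2 ⟨hh.lower, h, hl⟩⟩, rfl⟩

theorem exists_sinkPart_eq_cons (s : ℕ) (l : List ℕ) : ∃ z w, sinkPart s l = z :: w := by
  cases l with
  | nil => exact ⟨_, _, rfl⟩
  | cons x l =>
    rw [sinkPart]
    split_ifs
    exacts [⟨_, _, rfl⟩, ⟨_, _, rfl⟩]

theorem recoverable_cons_of_le {s x : ℕ} {l : List ℕ} (hs : Secondary s) (hx : Primary x)
    (h : lowerHalf s ≤ x) :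
    Recoverable s (x :: l) ↔ x + 12 < s ∧ (∀ z ∈ (sinkPart (s - 12) l).head?, z ≤ x) ∧
      Recoverable (s - 12) l := by
  obtain ⟨z, w, hw⟩ := exists_sinkPart_eq_cons (s - 12) l
  have h12 := hs.1
  rw [Recoverable, sinkPart, if_neg (by omega), Recoverable, hw, liftPair_eq_some]
  simp only [DistinctPrimary, List.head?_cons, Option.mem_def, Option.some.injEq, forall_eq']
  constructor
  · rintro ⟨⟨h1, h2, h3⟩, ⟨h4, h5, h6⟩ | ⟨h4, s', r', h5, h6, h7, h8⟩⟩
    · have := (IsHalves.mk h1 h3.head h2 (by omega) h5.symm).lowerHalf_eq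
      omega
    · simp only [Nat.add_sub_cancel, List.cons.injEq, true_and] at h8
      subst h8 h7
      -- Lifting only gives `x + 12 ≤ s`; equality would make a secondary number primary.
      refine ⟨?_, by omega, h3, by simpa using h5⟩
      unfold Primary at hx
      unfold Secondary at hs
      omega
  · rintro ⟨h1, h2, h3, h4⟩
    exact ⟨⟨hx.add_twelve, by omega, h3⟩,
      Or.inr ⟨by omega, _, _, h4, by omega, by omega, by simp⟩⟩

theorem Secondary.add_twelve_lt_of_lt {s x : ℕ} (hs : Secondary s) (hx : Primary x)
    (h : x < lowerHalf s) : x + 12 < s := by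
  obtain ⟨h1, h2, h3, h4, h5⟩ := hs.isHalves
  unfold Primary at *
  omega

theorem Secondary.twentyFour_le {s x : ℕ} (hs : Secondary s)
    (h : lowerHalf s ≤ x) (h' : x + 12 < s) : 24 ≤ s := by
  obtain ⟨h1, h2, h3, h4, h5⟩ := hs.isHalves
  unfold Primary at *
  omega

theorem recoverable_singleton {s x : ℕ} (hs : Secondary s) (hx : Primary x) :
    Recoverable s [x] ↔ x + 12 < s := by
  rcases lt_or_ge x (lowerHalf s) with h | h
  · exact iff_of_true (recoverable_of_lt hs hx (by simpa using h)) (hs.add_twelve_lt_of_lt hx h)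
  · rw [recoverable_cons_of_le hs hx h]
    refine ⟨And.left, fun h' => ⟨h', ?_, ?_⟩⟩
    · rw [sinkPart, hs.upperHalf_sub (hs.twentyFour_le h h')]
      simpa using h
    · exact recoverable_of_lt (hs.sub_twelve (hs.twentyFour_le h h')) trivial (by simp)

/-- If `s` passed both entries, the close pair `x + 12`, `y + 12` would be lifted instead. So `s`
must stop above `x` or between `x` and `y`. -/
theorem recoverable_cons_cons_of_lt {s x y : ℕ} {l : List ℕ} (hs : Secondary s)
    (hD : DistinctPrimary (x :: y :: l)) (hxy : x < y + 12) :
    Recoverable s (x :: y :: l) ↔ x < lowerHalf s ∨ (x + 12 < s ∧ y + 12 < upperHalf s) := by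
  rcases lt_or_ge x (lowerHalf s) with h | h
  · exact iff_of_true (recoverable_of_lt hs hD (by simpa using h)) (Or.inl h)
  rw [recoverable_cons_of_le hs hD.head h, or_iff_right (by omega)]
  refine and_congr_right fun h' => ?_
  have h24 := hs.twentyFour_le h h'
  have hlo := hs.lowerHalf_sub h24
  rw [sinkPart, hs.upperHalf_sub h24]
  constructor
  · rintro ⟨h1, -⟩
    split_ifs at h1 with h2
    · omega
    · simp at h1
      omega
  · intro h1
    rw [if_pos (by omega)]
    refine ⟨by simpa using h, recoverable_of_lt (hs.sub_twelve h24) hD.tail ?_⟩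
    simp
    omega

/-- Passing `x` creates no new close pair: the entry after `x + 12` is either `lowerHalf s` or `y +
12`, hence at most `x`. If `s` stops above `x`, both sides hold. -/
theorem recoverable_cons_cons_of_ge {s x y : ℕ} {l : List ℕ} (hs : Secondary s)
    (hD : DistinctPrimary (x :: y :: l)) (hxy : y + 12 ≤ x) :
    Recoverable s (x :: y :: l) ↔ x + 12 < s ∧ Recoverable (s - 12) (y :: l) := by
  have hy := hD.tail.head.four_le
  rcases lt_or_ge x (lowerHalf s) with h | h
  · refine iff_of_true (recoverable_of_lt hs hD (by simpa using h))
      ⟨hs.add_twelve_lt_of_lt hD.head h, ?_⟩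
    have hlt := hs.isHalves.lt
    have h24 : 24 ≤ s := by have := hs.isHalves.add; omega
    have hlo := hs.lowerHalf_sub h24
    refine recoverable_of_lt (hs.sub_twelve h24) hD.tail ?_
    simp
    omega
  · rw [recoverable_cons_of_le hs hD.head h]
    refine and_congr_right fun h' => and_iff_right ?_
    have h24 := hs.twentyFour_le h h'
    rw [sinkPart, hs.upperHalf_sub h24]
    split_ifs
    · simpa using h
    · simpa using hxy

/-- A finite check on residues. The difference 9 arises for halves with residues 10, 11 above 4, 8,
and with residues 4, 11 above 8, 10. -/
theorem lt_lowerHalf_or_iff {s x y : ℕ} (hs : Secondary s) (hx : Primary x) (hy : Primary y)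
    (hyx : y < x) (hxy : x < y + 12) :
    (x < lowerHalf s ∨ (x + 12 < s ∧ y + 12 < upperHalf s)) ↔
      (x + y + 12 < s ∨ (s = x + y + 9 ∧ (s % 12 = 3 ∨ s % 12 = 9))) := by
  obtain ⟨h1, h2, h3, h4, h5⟩ := hs.isHalves
  generalize upperHalf s = u at *
  generalize lowerHalf s = v at *
  subst h5
  clear hs
  have key : ∀ {m : ℕ}, Primary m → ∃ i a, m = 12 * i + a ∧ (a = 4 ∨ a = 8 ∨ a = 10 ∨ a = 11) :=
    fun {m} hm => ⟨m / 12, m % 12, by omega, hm⟩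
  obtain ⟨i, a, rfl, ha⟩ := key h1
  obtain ⟨j, b, rfl, hb⟩ := key h2
  obtain ⟨k, c, rfl, hc⟩ := key hx
  obtain ⟨l, d, rfl, hd⟩ := key hy
  clear h1 h2 hx hy key
  have hij : i = j ∨ i = j + 1 := by omega
  have hkl : k = l ∨ k = l + 1 := by omega
  rcases hij with rfl | rfl <;> rcases hkl with rfl | rfl <;>
  rcases ha with rfl | rfl | rfl | rfl <;> rcases hb with rfl | rfl | rfl | rfl <;>
    omega

/-- The first part of `regroup l`, for `l ≠ []`, together with the reason why it comes first. -/
theorem regroup_cases {l : List ℕ} (hD : DistinctPrimary l) {c : ℕ} (hc : c ∈ (regroup l).head?) :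
    (liftPair l = none ∧ c ∈ l.head? ∧ Primary c) ∨
      (∃ r, liftPair l = some (c, r) ∧ Secondary c ∧ regroup l = c :: regroup r) := by
  cases l with
  | nil => simp [regroup_nil] at hc
  | cons x l =>
    rcases h : liftPair (x :: l) with _ | ⟨s, r⟩
    · rw [regroup_of_none h] at hc
      simp at hc
      subst hc
      exact Or.inl ⟨rfl, rfl, hD.head⟩
    · have h' := regroup_of_some h
      rw [h'] at hc
      simp at hc
      subst hc
      exact Or.inr ⟨r, rfl, (liftPair_spec hD h).1, h'⟩

theorem recoverable_iff_of_liftPair_eq_none {s x : ℕ} {l : List ℕ} (hs : Secondary s)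
    (hD : DistinctPrimary (x :: l)) (hl : liftPair (x :: l) = none)
    (ih : ∀ s', Secondary s' → (Recoverable s' l ↔ GapBefore s' (regroup l))) :
    Recoverable s (x :: l) ↔ GapBefore s (regroup (x :: l)) := by
  rw [regroup_of_none hl, gapBefore_secondary_primary hs hD.head]
  cases l with
  | nil => exact recoverable_singleton hs hD.head
  | cons y l =>
    obtain ⟨hxy, hlift⟩ := liftPair_eq_none.1 hl
    have hy := hD.tail.head.four_le
    rw [recoverable_cons_cons_of_ge hs hD hxy]
    refine and_iff_left_of_imp fun h => ?_
    have hs' := hs.sub_twelve (by omega)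
    rw [ih _ hs']
    rcases h' : liftPair (y :: l) with _ | ⟨t, r⟩
    · rw [regroup_of_none h', gapBefore_secondary_primary hs' hD.tail.head]
      omega
    · have := hlift _ _ h'
      rw [regroup_of_some h', gapBefore_secondary hs']
      omega

theorem recoverable_iff_of_lt {s x y : ℕ} {l : List ℕ} (hs : Secondary s)
    (hD : DistinctPrimary (x :: y :: l)) (hxy : x < y + 12)
    (hW : WellSpaced (regroup (x :: y :: l))) :
    Recoverable s (x :: y :: l) ↔ GapBefore s (regroup (x :: y :: l)) := by
  have hx := hD.head
  have hy := hD.tail.head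
  have hh : IsHalves (x + y) x y := ⟨hx, hy, hD.2.1, hxy, rfl⟩
  rw [regroup_of_some (liftPair_of_lt hxy)] at hW ⊢
  rw [recoverable_cons_cons_of_lt hs hD hxy, lt_lowerHalf_or_iff hs hx hy hD.2.1 hxy,
    gapBefore_secondary hs]
  -- The condition on the third part `c` is automatic here. A primary `c` is below `y`, and the
  -- residues leave `x, y, c = 10, 8, 4` as the only failure of `c + 24 ≤ s`: this is the exempt
  -- triple. A secondary `c` is controlled by the gap below `x + y`.
  refine or_congr_right (and_congr_right fun h => (and_iff_left_of_imp fun h' => ?_).symm)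
  intro c hc
  rcases regroup_cases hD.tail.tail hc with ⟨-, hcl, hcp⟩ | ⟨r, -, hcs, hr⟩
  · have hcy := (distinctPrimary_cons.1 hD.tail).2.1 c hcl
    have hyx := hD.2.1
    unfold Primary at hx hy hcp
    omega
  · have h3 := hW.2.1
    rw [hr, gapBefore_secondary hh.secondary] at h3
    unfold Secondary at hcs
    omega

theorem recoverable_iff_of_ge {s x y s₁ : ℕ} {l r₁ : List ℕ} (hs : Secondary s)
    (hD : DistinctPrimary (x :: y :: l)) (hxy : y + 12 ≤ x)
    (hl : liftPair (y :: l) = some (s₁, r₁)) (hxs : x ≤ s₁ + 12)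
    (hW : WellSpaced (regroup (x :: y :: l))) (hW' : WellSpaced (regroup (y :: l)))
    (ih : ∀ s', Secondary s' → (Recoverable s' (y :: l) ↔ GapBefore s' (regroup (y :: l)))) :
    Recoverable s (x :: y :: l) ↔ GapBefore s (regroup (x :: y :: l)) := by
  have hl' : liftPair (x :: y :: l) = some (s₁ + 12, (x - 12) :: r₁) :=
    liftPair_eq_some.2 (Or.inr ⟨hxy, s₁, r₁, hl, hxs, rfl, rfl⟩)
  obtain ⟨h1s, h1D, -, -, -, -, h1y⟩ := liftPair_spec hD.tail hl
  obtain ⟨h2s, h2D, -⟩ := liftPair_spec hD hl'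
  have hx := hD.head
  have hy := hD.tail.head
  rw [regroup_of_some hl'] at hW ⊢
  rw [regroup_of_some hl] at hW' ih
  rw [recoverable_cons_cons_of_ge hs hD hxy, gapBefore_secondary hs]
  have hrw : x + 12 < s → (Recoverable (s - 12) (y :: l) ↔ s₁ + 12 < s - 12 ∨
      (s - 12 = s₁ + 9 ∧ ((s - 12) % 12 = 3 ∨ (s - 12) % 12 = 9) ∧
        ∀ c ∈ (regroup r₁).head?, c + 24 ≤ s - 12 ∨ (s - 12 = 27 ∧ s₁ = 18 ∧ c = 4))) := by
    intro h
    have hy4 := hy.four_le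
    have hs' := hs.sub_twelve (by omega)
    rw [ih _ hs', gapBefore_secondary hs']
  constructor
  · rintro ⟨h, hR⟩
    rcases (hrw h).1 hR with h1 | ⟨h1, h2, h3⟩
    · exact Or.inl (by omega)
    refine Or.inr ⟨by omega, by omega, fun c hc => Or.inl ?_⟩
    rcases regroup_cases h2D hc with ⟨-, hcl, -⟩ | ⟨r, -, hcs, hr⟩
    · simp at hcl
      omega
    · have h4 := hW.2.1
      rw [hr, gapBefore_secondary h2s] at h4
      unfold Secondary at hcs
      omega
  · rintro (h1 | ⟨h1, h2, h3⟩)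
    · have h : x + 12 < s := by omega
      exact ⟨h, (hrw h).2 (Or.inl (by omega))⟩
    have h12 := h1s.1
    -- This is what the condition on the third part encodes: that part is at least `x - 12`, and the
    -- exempt triple is excluded because the second part `s₁ + 12` is at least 24.
    have h : x + 12 < s := by
      have hle : x + 12 ≤ s := by
        obtain ⟨c, hc⟩ : ∃ c, c ∈ (regroup ((x - 12) :: r₁)).head? := by
          rw [regroup]
          split <;> simp
        have h4 := h3 c hc
        rcases regroup_cases h2D hc with ⟨-, hcl, -⟩ | ⟨r, hcr, -, -⟩
        · simp at hcl
          omega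
        · have := (liftPair_spec h2D hcr).2.2.2.2.2.1 _ rfl
          omega
      unfold Primary at hx
      omega
    refine ⟨h, (hrw h).2 (Or.inr ⟨by omega, by omega, fun c hc => ?_⟩)⟩
    rcases regroup_cases h1D hc with ⟨hcn, hcl, hcp⟩ | ⟨r, -, hcs, hr⟩
    · obtain ⟨r, rfl⟩ : ∃ r, r₁ = c :: r := by
        cases r₁ with
        | nil => simp at hcl
        | cons a r => simp at hcl; exact ⟨r, by rw [hcl]⟩
      have hcy := h1y _ rfl c hcl
      -- If `x - 12` and `c` are close, their sum is the third part and bounds `c` unless `y` is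
      -- small; the exempt triple reappears for `y, w, c = 10, 8, 4`.
      rcases lt_or_ge (x - 12) (c + 12) with h5 | h5
      · have h4 := h3 (x - 12 + c) (by rw [regroup_of_some (liftPair_of_lt h5)]; rfl)
        cases l with
        | nil => simp [liftPair] at hl
        | cons w l =>
          have hw := hD.tail.tail.head
          have hwy := hD.tail.2.1
          rcases liftPair_eq_some.1 hl with ⟨h6, h7, h8⟩ | ⟨h6, -⟩
          · subst h8
            have hcw := (distinctPrimary_cons.1 hD.tail.tail).2.1 c rfl
            unfold Primary at hx hy hw hcp
            omega
          · have := hw.four_le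
            unfold Primary at hx hy hw hcp
            omega
      · exact Or.inl (by omega)
    · have h4 := hW'.2.1
      rw [hr, gapBefore_secondary h1s] at h4
      unfold Secondary at hcs
      omega

/-- Sinking `s` into `l` can be undone if and only if `s` may precede the regrouping of `l`. -/
theorem recoverable_iff {l : List ℕ} (hD : DistinctPrimary l)
    (hW : ∀ l', DistinctPrimary l' → l'.length ≤ l.length → WellSpaced (regroup l')) :
    ∀ {s : ℕ}, Secondary s → (Recoverable s l ↔ GapBefore s (regroup l)) := by
  induction l with
  | nil =>
    intro s hs
    rw [regroup_nil]
    exact iff_of_true (recoverable_of_lt hs hD (by simp)) gapBefore_nil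
  | cons x l ih =>
    intro s hs
    have hW₁ : ∀ l', DistinctPrimary l' → l'.length ≤ l.length → WellSpaced (regroup l') :=
      fun l' hD' hle => hW l' hD' (by simp; omega)
    have ih' : ∀ s', Secondary s' → (Recoverable s' l ↔ GapBefore s' (regroup l)) :=
      fun _ hs' => ih hD.tail hW₁ hs'
    rcases hl : liftPair (x :: l) with _ | ⟨t, r⟩
    · exact recoverable_iff_of_liftPair_eq_none hs hD hl ih'
    cases l with
    | nil => simp [liftPair] at hl
    | cons y l =>
      rcases liftPair_eq_some.1 hl with ⟨hxy, -, -⟩ | ⟨hxy, s₁, r₁, hl₁, hxs, -, -⟩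
      · exact recoverable_iff_of_lt hs hD hxy (hW _ hD le_rfl)
      · exact recoverable_iff_of_ge hs hD hxy hl₁ hxs (hW _ hD le_rfl)
          (hW₁ _ hD.tail le_rfl) ih'

/-! ### Regrouping is a bijection onto well-spaced lists -/

theorem liftPair_cons_eq_none_iff {x : ℕ} {l : List ℕ} (hx : Primary x) (hD : DistinctPrimary l) :
    (DistinctPrimary (x :: l) ∧ liftPair (x :: l) = none) ↔ GapBefore x (regroup l) := by
  cases l with
  | nil => simp [regroup_nil, gapBefore_nil, liftPair, DistinctPrimary, hx]
  | cons y l =>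
    rw [liftPair_eq_none]
    rcases hl : liftPair (y :: l) with _ | ⟨s, r⟩
    · rw [regroup_of_none hl, gapBefore_primary_primary hx]
      simp only [reduceCtorEq, false_implies, implies_true, and_true]
      exact ⟨And.right, fun h => ⟨⟨hx, by omega, hD⟩, h⟩⟩
    · obtain ⟨hs, -, -, -, -, hys, -⟩ := liftPair_spec hD hl
      have hys := hys y rfl
      rw [regroup_of_some hl, gapBefore_primary_secondary hx hs]
      constructor
      · exact fun h => h.2.2 _ _ rfl
      · intro h
        refine ⟨⟨hx, by omega, hD⟩, by omega, ?_⟩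
        rintro _ _ ⟨⟩
        exact h

theorem wellSpaced_regroup {l : List ℕ} (hD : DistinctPrimary l) : WellSpaced (regroup l) := by
  induction h : l.length using Nat.strong_induction_on generalizing l with
  | _ n ih =>
    cases l with
    | nil => rw [regroup_nil]; trivial
    | cons x l =>
      simp only [List.length_cons] at h
      rcases hl : liftPair (x :: l) with _ | ⟨s, r⟩
      · rw [regroup_of_none hl]
        exact ⟨Or.inl hD.head, (liftPair_cons_eq_none_iff hD.head hD.tail).1 ⟨hD, hl⟩,
          ih _ (by omega) hD.tail rfl⟩
      · obtain ⟨hs, hr, hsink, hlen, -⟩ := liftPair_spec hD hl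
        simp only [List.length_cons] at hlen
        rw [regroup_of_some hl]
        refine ⟨Or.inr hs, ?_, ih _ (by omega) hr rfl⟩
        -- No circularity: `recoverable_iff` is applied to `r`, which is two entries shorter, and
        -- needs well-spacedness only up to that length.
        refine (recoverable_iff hr (fun l' hD' hle => ih _ (by omega) hD' rfl) hs).1 ?_
        rw [Recoverable, hsink]
        exact ⟨hD, hl⟩

/-- The inverse of `regroup`: splits up all secondary numbers. -/
def ungroup : List ℕ → List ℕ
  | [] => []
  | a :: l => if Primary a then a :: ungroup l else sinkPart a (ungroup l)

theorem ungroup_regroup {l : List ℕ} (hD : DistinctPrimary l) : ungroup (regroup l) = l := by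
  induction h : l.length using Nat.strong_induction_on generalizing l with
  | _ n ih =>
    cases l with
    | nil => rw [regroup_nil]; rfl
    | cons x l =>
      simp only [List.length_cons] at h
      rcases hl : liftPair (x :: l) with _ | ⟨s, r⟩
      · rw [regroup_of_none hl, ungroup, if_pos hD.head, ih _ (by omega) hD.tail rfl]
      · obtain ⟨hs, hr, hsink, hlen, -⟩ := liftPair_spec hD hl
        simp only [List.length_cons] at hlen
        rw [regroup_of_some hl, ungroup, if_neg fun hp => hp.not_secondary hs,
          ih _ (by omega) hr rfl, hsink]

theorem regroup_ungroup {l : List ℕ} (hW : WellSpaced l) :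
    DistinctPrimary (ungroup l) ∧ regroup (ungroup l) = l := by
  induction l with
  | nil => exact ⟨trivial, regroup_nil⟩
  | cons a l ih =>
    obtain ⟨ha, hgap, hl⟩ := hW
    obtain ⟨hD, heq⟩ := ih hl
    rw [← heq] at hgap
    rw [ungroup]
    split_ifs with hp
    · obtain ⟨h1, h2⟩ := (liftPair_cons_eq_none_iff hp hD).2 hgap
      exact ⟨h1, by rw [regroup_of_none h2, heq]⟩
    · obtain ⟨h1, h2⟩ := (recoverable_iff hD (fun _ h _ => wellSpaced_regroup h)
        (ha.resolve_left hp)).2 hgap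
      exact ⟨h1, by rw [regroup_of_some h2, heq]⟩

theorem sum_regroup {l : List ℕ} (hD : DistinctPrimary l) : (regroup l).sum = l.sum := by
  induction h : l.length using Nat.strong_induction_on generalizing l with
  | _ n ih =>
    cases l with
    | nil => rw [regroup_nil]
    | cons x l =>
      simp only [List.length_cons] at h
      rcases hl : liftPair (x :: l) with _ | ⟨s, r⟩
      · rw [regroup_of_none hl, List.sum_cons, ih _ (by omega) hD.tail rfl, List.sum_cons]
      · obtain ⟨-, hr, -, hlen, hsum, -⟩ := liftPair_spec hD hl
        simp only [List.length_cons] at hlen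
        rw [regroup_of_some hl, List.sum_cons, ih _ (by omega) hr rfl, hsum]

/-- Lists of distinct primary numbers correspond to well-spaced lists with the same sum. -/
def regroupEquiv (n : ℕ) :
    {l : List ℕ // DistinctPrimary l ∧ l.sum = n} ≃ {l : List ℕ // WellSpaced l ∧ l.sum = n} where
  toFun l := ⟨regroup l, wellSpaced_regroup l.2.1, by rw [sum_regroup l.2.1, l.2.2]⟩
  invFun l := ⟨ungroup l, (regroup_ungroup l.2.1).1, by
    rw [← sum_regroup (regroup_ungroup l.2.1).1, (regroup_ungroup l.2.1).2, l.2.2]⟩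
  left_inv l := Subtype.ext (ungroup_regroup l.2.1)
  right_inv l := Subtype.ext (regroup_ungroup l.2.1).2

/-! ### Translation to partitions -/

theorem isPrimaryResidue_iff {m : ℕ} : IsPrimaryResidue m ↔ Primary m := by
  unfold IsPrimaryResidue Primary Int.ModEq
  omega

/-- The excluded values 2, 3, 6, 7, 9 are the positive numbers below 12 with the residue of a
secondary number: they are too small to be sums of two primary numbers. -/
theorem isAllowedPart_iff {m : ℕ} (hm : 0 < m) : IsAllowedPart m ↔ Primary m ∨ Secondary m := by
  unfold IsAllowedPart Primary Secondary Nat.ModEq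
  omega

theorem distinctPrimary_iff {l : List ℕ} :
    DistinctPrimary l ↔ l.Pairwise (· > ·) ∧ ∀ m ∈ l, Primary m := by
  induction l with
  | nil => simp [DistinctPrimary]
  | cons x l ih =>
    rw [distinctPrimary_cons, ih]
    simp only [List.pairwise_cons, List.mem_cons, forall_eq_or_imp]
    constructor
    · rintro ⟨hx, hlt, hp, hl⟩
      refine ⟨⟨?_, hp⟩, hx, hl⟩
      cases l with
      | nil => simp
      | cons y l =>
        have hy : y < x := hlt y rfl
        intro z hz
        rcases List.mem_cons.1 hz with rfl | hz
        · exact hy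
        · exact (List.rel_of_pairwise_cons hp hz).trans hy
    · rintro ⟨⟨hlt, hp⟩, hx, hl⟩
      exact ⟨hx, fun y hy => hlt y (List.mem_of_mem_head? hy), hp, hl⟩

theorem gapConditions_cons {a : ℕ} {l : List ℕ} :
    GapConditions (a :: l) ↔ GapBefore a l ∧ GapConditions l := by
  have h0 : GapBefore a l ↔ ∀ _ : 0 + 1 < (a :: l).length,
      (((a :: l)[0] : ℤ) - ((a :: l)[0 + 1] : ℤ) > 12) ∨
      (((a :: l)[0] : ℤ) - ((a :: l)[0 + 1] : ℤ) = 12 ∧ IsPrimaryResidue (a :: l)[0]) ∨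
      (((a :: l)[0] : ℤ) - ((a :: l)[0 + 1] : ℤ) = 9 ∧
        (((a :: l)[0] : ℤ) ≡ 3 [ZMOD 12] ∨ ((a :: l)[0] : ℤ) ≡ -3 [ZMOD 12]) ∧
        ∀ _ : 0 + 2 < (a :: l).length,
          ((a :: l)[0] : ℤ) - ((a :: l)[0 + 2] : ℤ) ≥ 24 ∨
            ((a :: l)[0] = 27 ∧ (a :: l)[0 + 1] = 18 ∧ (a :: l)[0 + 2] = 4)) := by
    rcases l with _ | ⟨b, _ | ⟨c, l⟩⟩
    · simp [GapBefore]
    · simp [GapBefore, isPrimaryResidue_iff, Int.ModEq]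
      by_cases hp : Primary a <;> simp only [hp, and_true, and_false, false_or] <;> omega
    · simp [GapBefore, isPrimaryResidue_iff, Int.ModEq]
      by_cases hp : Primary a <;> simp only [hp, and_true, and_false, false_or] <;> omega
  rw [h0]
  constructor
  · intro h
    refine ⟨h 0, fun i hi => ?_⟩
    exact (h (i + 1) (Nat.succ_lt_succ hi)).imp_right (Or.imp_right (And.imp_right
      (And.imp_right fun h' hi' => h' (Nat.succ_lt_succ hi'))))
  · rintro ⟨h1, h2⟩ i hi
    cases i with
    | zero => exact h1 hi
    | succ i =>
      exact (h2 i (Nat.lt_of_succ_lt_succ hi)).imp_right (Or.imp_right (And.imp_right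
        (And.imp_right fun h' hi' => h' (Nat.lt_of_succ_lt_succ hi'))))

theorem wellSpaced_iff {l : List ℕ} :
    WellSpaced l ↔ (∀ m ∈ l, 0 < m) ∧ (∀ m ∈ l, IsAllowedPart m) ∧ GapConditions l := by
  induction l with
  | nil => simp [WellSpaced, GapConditions]
  | cons a l ih =>
    rw [WellSpaced, ih, gapConditions_cons]
    simp only [List.mem_cons, forall_eq_or_imp]
    have ha : Primary a ∨ Secondary a ↔ 0 < a ∧ IsAllowedPart a := by
      constructor
      · intro h
        have hpos : 0 < a := h.elim (fun h => by have := h.four_le; omega)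
          (fun h => by have := h.1; omega)
        exact ⟨hpos, (isAllowedPart_iff hpos).2 h⟩
      · exact fun h => (isAllowedPart_iff h.1).1 h.2
    rw [ha]
    tauto

theorem WellSpaced.pairwise {l : List ℕ} (h : WellSpaced l) : l.Pairwise (· ≥ ·) := by
  rw [← List.isChain_iff_pairwise]
  induction l with
  | nil => exact .nil
  | cons a l ih =>
    cases l with
    | nil => exact .singleton a
    | cons b l =>
      refine List.isChain_cons_cons.2 ⟨?_, ih h.2.2⟩
      have := gapBefore_cons.1 h.2.1
      omega

theorem mem_partsDesc {n m : ℕ} {p : n.Partition} : m ∈ partsDesc p ↔ m ∈ p.parts := by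
  simp [partsDesc]

theorem isFirstKind_iff {n : ℕ} (p : n.Partition) :
    IsFirstKind p ↔ DistinctPrimary (partsDesc p) := by
  have hs : (partsDesc p).Pairwise (· ≥ ·) := Multiset.pairwise_sort _ _
  have hnd : p.parts.Nodup ↔ (partsDesc p).Nodup := by
    rw [← Multiset.coe_nodup, partsDesc, Multiset.sort_eq]
  simp only [IsFirstKind, distinctPrimary_iff, isPrimaryResidue_iff, mem_partsDesc, hnd]
  refine and_congr_left fun _ => ⟨fun h => ?_, fun h => h.imp ne_of_gt⟩
  exact (hs.and h).imp fun h => lt_of_le_of_ne h.1 h.2.symm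

theorem isSecondKind_iff {n : ℕ} (p : n.Partition) :
    IsSecondKind p ↔ WellSpaced (partsDesc p) := by
  simp only [IsSecondKind, wellSpaced_iff, mem_partsDesc]
  exact ⟨fun h => ⟨fun _ hm => p.parts_pos hm, h⟩, And.right⟩

theorem partsDesc_ofList {n : ℕ} {l : List ℕ} (hl : l.Pairwise (· ≥ ·))
    (hpos : ∀ {m}, m ∈ (l : Multiset ℕ) → 0 < m) (hsum : (l : Multiset ℕ).sum = n) :
    partsDesc (⟨l, hpos, hsum⟩ : n.Partition) = l := by
  rw [partsDesc, Multiset.coe_sort, List.mergeSort_eq_self _ hl]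

/-- Partitions correspond to the lists of their parts in non-increasing order. -/
def partitionEquivList {n : ℕ} (C : List ℕ → Prop) (hC : ∀ l, C l → l.Pairwise (· ≥ ·))
    (hpos : ∀ l, C l → ∀ m ∈ l, 0 < m) :
    {p : n.Partition // C (partsDesc p)} ≃ {l : List ℕ // C l ∧ l.sum = n} where
  toFun p := ⟨partsDesc p.1, p.2, by
    rw [← Multiset.sum_coe, partsDesc, Multiset.sort_eq, p.1.parts_sum]⟩
  invFun l := ⟨⟨l.1, fun hm => hpos _ l.2.1 _ (by simpa using hm), by simpa using l.2.2⟩, by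
    rw [partsDesc_ofList (hC _ l.2.1)]
    exact l.2.1⟩
  left_inv p := by
    ext1; ext1
    simp [partsDesc]
  right_inv l := Subtype.ext (partsDesc_ofList (hC _ l.2.1)
    (fun hm => hpos _ l.2.1 _ (by simpa using hm)) (by simpa using l.2.2))

theorem corollary1p1 (n : ℕ) :
    Nat.card {p : n.Partition // IsFirstKind p} =
      Nat.card {p : n.Partition // IsSecondKind p} := by
  simp only [isFirstKind_iff, isSecondKind_iff]
  have e₁ := partitionEquivList (n := n) DistinctPrimary
    (fun l h => (distinctPrimary_iff.1 h).1.imp le_of_lt)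
    (fun l h m hm => by have := ((distinctPrimary_iff.1 h).2 m hm).four_le; omega)
  have e₂ := partitionEquivList (n := n) WellSpaced (fun l h => h.pairwise)
    (fun l h => (wellSpaced_iff.1 h).1)
  exact Nat.card_congr (e₁.trans ((regroupEquiv n).trans e₂.symm))
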